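/- Let $p\ge q\ge 2$ and $k\ge 2$ be integers. Write $\log_0 r=r$ and $\log_{n+1}r=\log(\log_n r)$ for large $r$; let $M(r,A)=\max_{|z|=r}|A(z)|$, and let $T(r,f)$ be the Nevanlinna characteristic of a meromorphic function $f$ on $\mathbb C$. For an entire function $A$ put $$\rho_A=\limsup_{r\to\infty}\frac{\log_{p+1}M(r,A)}{\log_q r},\qquad \underline\rho_A=\liminf_{r\to\infty}\frac{\log_{p+1}M(r,A)}{\log_q r}$$ (the $(p,q)$-order and $(p,q)$-lower order), with $\rho_A=\underline\rho_A=0$ when $A$ is a polynomial (including the zero polynomial). If $0<\rho_A<\infty$, respectively $0<\underline\rho_A<\infty$, put $$\tau_A=\limsup_{r\to\infty}\frac{\log_{p}M(r,A)}{(\log_{q-1} r)^{\rho_A}},\qquad\text{respectively}\qquad \underline\tau_A=\liminf_{r\to\infty}\frac{\log_{p}M(r,A)}{(\log_{q-1} r)^{\underline\rho_A}}$$ (the $(p,q)$-type and $(p,q)$-lower type). For a meromorphic function $f$ put $\rho_f=\limsup_{r\to\infty}\frac{\log_p T(r,f)}{\log_q r}$, with $\rho_f=0$ when $f$ is rational.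 Let $c_1,\dots,c_k$ be distinct nonzero complex numbers and let $A_0,\dots,A_{k+1}$ be entire functions. (The case where $A_{k+1}$ is identically zero is allowed; the equation below is then homogeneous.) Suppose that there are indices $l,m\in\{0,\dots,k+1\}$ such that 1. $0<\max\bigl\{\underline\rho_{A_m},\ \rho_{A_j}\ (j\ne l,m)\bigr\}\le\underline\rho_{A_l}<\infty$; 2. if $\underline\rho_{A_l}=\underline\rho_{A_m}$, then $\underline\tau_{A_l}>\underline\tau_{A_m}$; 3. if $\underline\rho_{A_l}=\max\{\rho_{A_j}: j\ne l,m\}$, then $\max\{\tau_{A_j}:\ j\ne l,m,\ \rho_{A_j}=\underline\rho_{A_l}\}<\underline\tau_{A_l}$. Then every meromorphic function $f\not\equiv0$ on $\mathbb C$ that satisfies $$A_k(z)f(z+c_k)+\cdots+A_1(z)f(z+c_1)+A_0(z)f(z)=A_{k+1}(z)$$ has $\rho_f\ge\underline\rho_{A_l}$. -/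

import Mathlib

open Filter

noncomputable section

/-- The `n`-fold iterated logarithm `log_n x`, with `log_0 x = x` and
`log_{n+1} x = log (log_n x)`; only its values at large `x` matter. -/
def iterLog (n : ℕ) (x : ℝ) : ℝ := Real.log^[n] x

/-- The maximum modulus `M(r, f) = max_{|z| = r} |f z|`. -/
def maxModulus (f : ℂ → ℂ) (r : ℝ) : ℝ :=
  sSup ((fun z => ‖f z‖) '' Metric.sphere (0 : ℂ) r)

/-- The `(p,q)`-order of a meromorphic function `f`, the upper limit of `log_p T(r, f) / log_q r`,
where `T(r, f)` is the Nevanlinna characteristic. -/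
def meromorphicPQOrder (p q : ℕ) (f : ℂ → ℂ) : EReal :=
  limsup (fun r : ℝ =>
    ((iterLog p (ValueDistribution.characteristic f ⊤ r) / iterLog q r : ℝ) : EReal)) atTop

/-- The `(p,q)`-order of an entire function `f`, the upper limit of
`log_{p+1} M(r, f) / log_q r`. -/
def entirePQOrder (p q : ℕ) (f : ℂ → ℂ) : EReal :=
  limsup (fun r : ℝ =>
    ((iterLog (p + 1) (maxModulus f r) / iterLog q r : ℝ) : EReal)) atTop

/-- The `(p,q)`-lower order of an entire function `f`, the lower limit of
`log_{p+1} M(r, f) / log_q r`. -/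
def entirePQLowerOrder (p q : ℕ) (f : ℂ → ℂ) : EReal :=
  liminf (fun r : ℝ =>
    ((iterLog (p + 1) (maxModulus f r) / iterLog q r : ℝ) : EReal)) atTop

/-- The `(p,q)`-type of an entire function `f` of positive finite `(p,q)`-order `ρ`, the upper
limit of `log_p M(r, f) / (log_{q-1} r) ^ ρ` (for `q ≥ 1`). -/
def entirePQType (p q : ℕ) (f : ℂ → ℂ) : EReal :=
  limsup (fun r : ℝ =>
    ((iterLog p (maxModulus f r) /
      (iterLog (q - 1) r) ^ (entirePQOrder p q f).toReal : ℝ) : EReal)) atTop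

/-- The `(p,q)`-lower type of an entire function `f` of positive finite `(p,q)`-lower order `ρ`,
the lower limit of `log_p M(r, f) / (log_{q-1} r) ^ ρ` (for `q ≥ 1`). -/
def entirePQLowerType (p q : ℕ) (f : ℂ → ℂ) : EReal :=
  liminf (fun r : ℝ =>
    ((iterLog p (maxModulus f r) /
      (iterLog (q - 1) r) ^ (entirePQLowerOrder p q f).toReal : ℝ) : EReal)) atTop

/-- `f` is a solution, as a meromorphic function, of the linear difference equation
`A_k(z) f(z + c_k) + ⋯ + A_1(z) f(z + c_1) + A_0(z) f(z) = A_{k+1}(z)`.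
Here `c j` stands for `c_{j+1}`. The identity is one between meromorphic functions, so it is
required off a closed discrete set (values at poles carry no meaning). The equation is homogeneous
when `A_{k+1}` is the zero function. -/
def IsMeromorphicSolution {k : ℕ} (A : Fin (k + 2) → ℂ → ℂ) (c : Fin k → ℂ) (f : ℂ → ℂ) : Prop :=
  Meromorphic f ∧
    (fun z => A 0 z * f z + ∑ j : Fin k, A j.succ.castSucc z * f (z + c j))
      =ᶠ[codiscrete ℂ] A (Fin.last (k + 1))

end

/-! Write n = p - 1, e = q - 1 and let μ be the lower order of A_l; suppose ρ_f < μ. With A_{k+1}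
moved to the left, the equation is a vanishing combination of the A_j whose multipliers are the
shifts of f and -1. Solving for A_l bounds log⁺|A_l| almost everywhere by a constant, the log⁺|A_j|
with j ≠ l, and log⁺ of the shifts of f and of their reciprocals.

This bound is averaged over area. By subharmonicity, log|A_l| at a maximum point z with |z| = 2R is
controlled by area integrals over R/2 < |w - z| < R. The shifts move that annulus within R/2 < |u| <
4R, where polar coordinates bound the integrals of log⁺|f| and log⁺|1/f| by proximity functions,
hence by T(s, f) + O(1). No quotient f(z + c)/f(z) is estimated and no exceptional set of radii
arises.

Take 3R = r along radii where A_m is small; the lower bound for A_l holds at all large radii, so it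
is available there. Then exp_n(b (log_e(2r/3))^ν) ≤ C exp_n(a (log_e(4r/3))^ν) with a < b, which is
impossible for large r: as e ≥ 1 the dilation, and as n ≥ 1 the factor C, cost only a slight
increase of a. If the orders leave a gap below μ, ν is chosen in it; otherwise ν = μ and a < b
separate the types (`frequently_characteristic_gt_of_dominant_coefficient`). -/

/-! ### Iterated logarithms and exponentials -/

lemma iterLog_succ (n : ℕ) (x : ℝ) : iterLog (n + 1) x = Real.log (iterLog n x) :=
  Function.iterate_succ_apply' _ _ _

lemma tendsto_iterLog (n : ℕ) : Tendsto (iterLog n) atTop atTop :=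
  Tendsto.iterate Real.tendsto_log_atTop n

lemma tendsto_exp_iterate (n : ℕ) : Tendsto (Real.exp^[n]) atTop atTop :=
  Tendsto.iterate Real.tendsto_exp_atTop n

lemma monotone_exp_iterate (n : ℕ) : Monotone (Real.exp^[n]) :=
  Real.exp_monotone.iterate n

/-- No largeness of x is needed: where an intermediate logarithm is nonpositive, it lies below every
exponential. -/
lemma le_exp_iterate_of_iterLog_le {n : ℕ} {x y : ℝ} (h : iterLog n x ≤ y) :
    x ≤ Real.exp^[n] y := by
  induction n generalizing y with
  | zero => exact h
  | succ n ih =>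
    rw [iterLog_succ] at h
    rw [Function.iterate_succ_apply]
    apply ih
    rcases le_or_gt (iterLog n x) 0 with h0 | h0
    · exact h0.trans (Real.exp_pos y).le
    · exact (Real.log_le_iff_le_exp h0).1 h

lemma eventually_exp_iterate_le_of_le_iterLog (n : ℕ) :
    ∀ᶠ x : ℝ in atTop, ∀ y, y ≤ iterLog n x → Real.exp^[n] y ≤ x := by
  induction n with
  | zero => exact Eventually.of_forall fun x y h => h
  | succ n ih =>
    filter_upwards [ih, (tendsto_iterLog n).eventually_gt_atTop 0] with x hx h0 y hy
    rw [iterLog_succ] at hy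
    rw [Function.iterate_succ_apply]
    exact hx _ ((Real.le_log_iff_exp_le h0).1 hy)

lemma eventually_iterLog_le_iterLog (n : ℕ) :
    ∀ᶠ x : ℝ in atTop, ∀ y, x ≤ y → iterLog n x ≤ iterLog n y := by
  induction n with
  | zero => exact Eventually.of_forall fun x y h => h
  | succ n ih =>
    filter_upwards [ih, (tendsto_iterLog n).eventually_gt_atTop 0] with x hx h0 y hy
    rw [iterLog_succ, iterLog_succ]
    exact Real.log_le_log h0 (hx y hy)

lemma exists_iterLog_mul_le_add {c : ℝ} (hc : 0 < c) {n : ℕ} (hn : 1 ≤ n) :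
    ∃ K, ∀ᶠ r : ℝ in atTop, iterLog n (c * r) ≤ iterLog n r + K := by
  induction n, hn using Nat.le_induction with
  | base =>
    refine ⟨Real.log c, ?_⟩
    filter_upwards [eventually_gt_atTop 0] with r hr
    change Real.log (c * r) ≤ Real.log r + Real.log c
    rw [Real.log_mul hc.ne' hr.ne', add_comm]
  | succ n hn ih =>
    obtain ⟨K, hK⟩ := ih
    -- Once log_n r ≥ K, adding K at most doubles it.
    refine ⟨Real.log 2, ?_⟩
    have hcr : Tendsto (fun r => iterLog n (c * r)) atTop atTop :=
      (tendsto_iterLog n).comp (tendsto_id.const_mul_atTop hc)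
    filter_upwards [hK, (tendsto_iterLog n).eventually_gt_atTop 0,
      (tendsto_iterLog n).eventually_ge_atTop K, hcr.eventually_gt_atTop 0] with r h1 h2 h3 h4
    rw [iterLog_succ, iterLog_succ, ← Real.log_mul h2.ne' two_ne_zero]
    exact Real.log_le_log h4 (by linarith)

/-- A dilation adds only a bounded amount to log_n, so it changes the power by a factor tending to
1. -/
lemma eventually_mul_iterLog_rpow_le {a b c ν : ℝ} (ha : 0 < a) (hab : a < b) (hc : 0 < c)
    (hν : 0 < ν) {n : ℕ} (hn : 1 ≤ n) :
    ∀ᶠ r : ℝ in atTop, a * iterLog n (c * r) ^ ν ≤ b * iterLog n r ^ ν := by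
  obtain ⟨K, hK⟩ := exists_iterLog_mul_le_add hc hn
  have hcr : Tendsto (fun r => iterLog n (c * r)) atTop atTop :=
    (tendsto_iterLog n).comp (tendsto_id.const_mul_atTop hc)
  have hlim : Tendsto (fun r => a * (1 + K / iterLog n r) ^ ν) atTop (nhds a) := by
    have h1 : Tendsto (fun r => 1 + K / iterLog n r) atTop (nhds (1 + 0)) :=
      tendsto_const_nhds.add (tendsto_const_nhds.div_atTop (tendsto_iterLog n))
    rw [add_zero] at h1
    have h2 := (h1.rpow_const (p := ν) (Or.inl one_ne_zero)).const_mul a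
    simpa using h2
  filter_upwards [hK, (tendsto_iterLog n).eventually_gt_atTop 0, hcr.eventually_gt_atTop 0,
    hlim.eventually_lt_const hab] with r h1 h2 h3 h4
  have h5 : iterLog n (c * r) ≤ (1 + K / iterLog n r) * iterLog n r := by
    rw [add_mul, div_mul_cancel₀ _ h2.ne']; linarith
  have h6 : 0 ≤ 1 + K / iterLog n r := by
    by_contra h
    exact absurd (h5.trans (mul_neg_of_neg_of_pos (not_le.1 h) h2).le) (not_le.2 h3)
  calc a * iterLog n (c * r) ^ ν ≤ a * ((1 + K / iterLog n r) * iterLog n r) ^ ν := by gcongr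
    _ = (a * (1 + K / iterLog n r) ^ ν) * iterLog n r ^ ν := by
      rw [Real.mul_rpow h6 h2.le]; ring
    _ ≤ b * iterLog n r ^ ν := by gcongr

lemma eventually_mul_exp_iterate_lt {a b : ℝ} (ha : 0 < a) (hab : a < b) {n : ℕ} (hn : 1 ≤ n)
    (C : ℝ) : ∀ᶠ x : ℝ in atTop, C * Real.exp^[n] (a * x) < Real.exp^[n] (b * x) := by
  induction n, hn using Nat.le_induction generalizing C with
  | base =>
    have h : Tendsto (fun x => Real.exp ((b - a) * x)) atTop atTop :=
      Real.tendsto_exp_atTop.comp (tendsto_id.const_mul_atTop (sub_pos.2 hab))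
    filter_upwards [h.eventually_gt_atTop C] with x hx
    change C * Real.exp (a * x) < Real.exp (b * x)
    rw [show b * x = (b - a) * x + a * x by ring, Real.exp_add]
    gcongr
  | succ n hn ih =>
    have h : Tendsto (fun x => Real.exp (Real.exp^[n] (a * x))) atTop atTop :=
      Real.tendsto_exp_atTop.comp ((tendsto_exp_iterate n).comp (tendsto_id.const_mul_atTop ha))
    -- The factor C is below the exponential itself, so it costs a doubling of the exponent, which
    -- the induction hypothesis with constant 2 absorbs.
    filter_upwards [ih 2, h.eventually_gt_atTop C] with x hx hC
    rw [Function.iterate_succ_apply', Function.iterate_succ_apply']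
    calc C * Real.exp (Real.exp^[n] (a * x))
        < Real.exp (Real.exp^[n] (a * x)) * Real.exp (Real.exp^[n] (a * x)) := by gcongr
      _ = Real.exp (2 * Real.exp^[n] (a * x)) := by rw [← Real.exp_add, two_mul]
      _ ≤ _ := Real.exp_le_exp.2 hx.le

lemma eventually_iterLog_rpow_le {β μ a : ℝ} (hβ : β < μ) (ha : 0 < a) (n : ℕ) :
    ∀ᶠ r : ℝ in atTop, iterLog n r ^ β ≤ a * iterLog n r ^ μ := by
  have h : Tendsto (fun r => iterLog n r ^ (μ - β)) atTop atTop :=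
    (tendsto_rpow_atTop (sub_pos.2 hβ)).comp (tendsto_iterLog n)
  filter_upwards [(tendsto_iterLog n).eventually_gt_atTop 0, h.eventually_ge_atTop a⁻¹] with r h0 h1
  rw [show μ = (μ - β) + β by ring, Real.rpow_add h0, ← mul_assoc]
  have : 1 ≤ a * iterLog n r ^ (μ - β) := by
    rwa [inv_le_iff_one_le_mul₀' ha] at h1
  exact le_mul_of_one_le_left (Real.rpow_nonneg h0.le _) this

/-- A bound on the ratio `log_{n+1} x / log_{e+1} r` as a bound of `log_n x` by a power. -/
lemma iterLog_le_rpow_of_div_lt {n e : ℕ} {x r β : ℝ} (hr : 1 < iterLog e r)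
    (h : iterLog (n + 1) x / iterLog (e + 1) r < β) : iterLog n x ≤ iterLog e r ^ β := by
  rw [iterLog_succ, iterLog_succ, div_lt_iff₀ (Real.log_pos hr)] at h
  have h0 : 0 < iterLog e r := by linarith
  rcases le_or_gt (iterLog n x) 0 with hx | hx
  · exact hx.trans (Real.rpow_nonneg h0.le _)
  · rw [Real.rpow_def_of_pos h0, mul_comm]
    exact ((Real.log_lt_iff_lt_exp hx).1 h).le

lemma rpow_le_iterLog_of_lt_div {n e : ℕ} {x r β : ℝ} (hr : 1 < iterLog e r)
    (hx : 0 < iterLog n x) (h : β < iterLog (n + 1) x / iterLog (e + 1) r) :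
    iterLog e r ^ β ≤ iterLog n x := by
  rw [iterLog_succ, iterLog_succ, lt_div_iff₀ (Real.log_pos hr)] at h
  rw [Real.rpow_def_of_pos (by linarith), mul_comm]
  exact ((Real.lt_log_iff_exp_lt hx).1 h).le

/-! ### Maximum modulus; orders and types of entire functions -/

lemma bddAbove_norm_image_sphere {f : ℂ → ℂ} (hf : Continuous f) (r : ℝ) :
    BddAbove ((fun z => ‖f z‖) '' Metric.sphere (0 : ℂ) r) :=
  (isCompact_sphere 0 r).bddAbove_image hf.norm.continuousOn

lemma exists_norm_eq_maxModulus {f : ℂ → ℂ} (hf : Continuous f) {r : ℝ} (hr : 0 ≤ r) :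
    ∃ z, ‖z‖ = r ∧ ‖f z‖ = maxModulus f r := by
  have hne : (Metric.sphere (0 : ℂ) r).Nonempty := NormedSpace.sphere_nonempty.2 hr
  have := ((isCompact_sphere (0 : ℂ) r).image hf.norm).sSup_mem (hne.image _)
  obtain ⟨z, hz, h⟩ := this
  exact ⟨z, by simpa using hz, h⟩

lemma norm_le_maxModulus {f : ℂ → ℂ} (hf : Differentiable ℂ f) {r : ℝ} {z : ℂ} (hz : ‖z‖ ≤ r) :
    ‖f z‖ ≤ maxModulus f r := by
  rcases hz.eq_or_lt with h | h
  · exact le_csSup (bddAbove_norm_image_sphere hf.continuous r) ⟨z, by simpa using h, rfl⟩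
  have hr : 0 < r := (norm_nonneg z).trans_lt h
  refine Complex.norm_le_of_forall_mem_frontier_norm_le (U := Metric.ball 0 r)
    Metric.isBounded_ball hf.diffContOnCl (fun w hw => ?_) (subset_closure (by simpa using h))
  rw [frontier_ball _ hr.ne'] at hw
  exact le_csSup (bddAbove_norm_image_sphere hf.continuous r) ⟨w, hw, rfl⟩

lemma maxModulus_const (a : ℂ) {r : ℝ} (hr : 0 ≤ r) : maxModulus (fun _ => a) r = ‖a‖ := by
  obtain ⟨z, -, h⟩ := exists_norm_eq_maxModulus (continuous_const (y := a)) hr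
  exact h.symm

/-- Liouville's theorem together with the maximum principle. -/
lemma maxModulus_tendsto_or_const {f : ℂ → ℂ} (hf : Differentiable ℂ f) :
    Tendsto (maxModulus f) atTop atTop ∨ ∃ a, f = fun _ => a := by
  by_cases hb : Bornology.IsBounded (Set.range f)
  · exact Or.inr ⟨f 0, funext fun z => hf.apply_eq_apply_of_bounded hb z 0⟩
  left
  refine tendsto_atTop.2 fun C => ?_
  have : ∃ z, C < ‖f z‖ := by
    by_contra! h
    exact hb (isBounded_iff_forall_norm_le.2 ⟨C, by rintro _ ⟨z, rfl⟩; exact h z⟩)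
  obtain ⟨z, hz⟩ := this
  filter_upwards [eventually_ge_atTop ‖z‖] with r hr
  exact hz.le.trans (norm_le_maxModulus hf hr)

lemma tendsto_order_ratio_const (p q : ℕ) (a : ℂ) :
    Tendsto (fun r : ℝ =>
      ((iterLog (p + 1) (maxModulus (fun _ => a) r) / iterLog q r : ℝ) : EReal)) atTop (nhds 0) := by
  have h : Tendsto (fun r : ℝ => iterLog (p + 1) ‖a‖ / iterLog q r) atTop (nhds 0) :=
    tendsto_const_nhds.div_atTop (tendsto_iterLog q)
  have h2 := (continuous_coe_real_ereal.tendsto 0).comp h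
  rw [EReal.coe_zero] at h2
  refine h2.congr' ?_
  filter_upwards [eventually_ge_atTop 0] with r hr
  simp [maxModulus_const a hr]

lemma tendsto_maxModulus_of_lowerOrder_pos {p q : ℕ} {f : ℂ → ℂ} (hf : Differentiable ℂ f)
    (h : 0 < entirePQLowerOrder p q f) : Tendsto (maxModulus f) atTop atTop := by
  rcases maxModulus_tendsto_or_const hf with h1 | ⟨a, rfl⟩
  · exact h1
  · exact absurd (tendsto_order_ratio_const p q a).liminf_eq h.ne'

lemma tendsto_maxModulus_of_order_pos {p q : ℕ} {f : ℂ → ℂ} (hf : Differentiable ℂ f)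
    (h : 0 < entirePQOrder p q f) : Tendsto (maxModulus f) atTop atTop := by
  rcases maxModulus_tendsto_or_const hf with h1 | ⟨a, rfl⟩
  · exact h1
  · exact absurd (tendsto_order_ratio_const p q a).limsup_eq h.ne'

lemma eventually_type_ratio_nonneg {f : ℂ → ℂ} (h : Tendsto (maxModulus f) atTop atTop)
    (p e : ℕ) (ν : ℝ) :
    ∀ᶠ r : ℝ in atTop, (0 : EReal) ≤
      ((iterLog p (maxModulus f r) / iterLog e r ^ ν : ℝ) : EReal) := by
  filter_upwards [((tendsto_iterLog p).comp h).eventually_ge_atTop 0,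
    (tendsto_iterLog e).eventually_ge_atTop 0] with r h1 h2
  exact EReal.coe_nonneg.2 (div_nonneg h1 (Real.rpow_nonneg h2 _))

lemma entirePQLowerType_nonneg {f : ℂ → ℂ} (h : Tendsto (maxModulus f) atTop atTop)
    (p q : ℕ) : 0 ≤ entirePQLowerType p q f :=
  le_liminf_of_le (by isBoundedDefault) (eventually_type_ratio_nonneg h _ _ _)

lemma entirePQType_nonneg {f : ℂ → ℂ} (h : Tendsto (maxModulus f) atTop atTop)
    (p q : ℕ) : 0 ≤ entirePQType p q f :=
  le_limsup_of_frequently_le (eventually_type_ratio_nonneg h _ _ _).frequently (by isBoundedDefault)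

/-! ### Area means of log⁺ and subharmonicity -/

section

open MeasureTheory Real ValueDistribution

lemma lintegral_complex_polar {f : ℂ → ENNReal} (hf : Measurable f) :
    ∫⁻ z, f z = ∫⁻ r in Set.Ioi (0 : ℝ), ∫⁻ θ in Set.Ioo (-π) π,
      ENNReal.ofReal r * f (circleMap 0 r θ) := by
  rw [← Complex.lintegral_comp_polarCoord_symm, polarCoord_target, Measure.volume_eq_prod,
    ← Measure.prod_restrict, lintegral_prod]
  · simp [Complex.polarCoord_symm_apply, circleMap, Complex.exp_mul_I]
  · simp only [Complex.polarCoord_symm_apply, smul_eq_mul]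
    refine Measurable.aemeasurable ?_
    fun_prop

lemma lintegral_circle {g : ℂ → ℝ} (hg0 : ∀ z, 0 ≤ g z) {r : ℝ} (hr : 0 ≤ r)
    (hg : CircleIntegrable g 0 r) :
    ∫⁻ θ in Set.Ioo (-π) π, ENNReal.ofReal r * ENNReal.ofReal (g (circleMap 0 r θ)) =
      ENNReal.ofReal (2 * π * r * circleAverage g 0 r) := by
  have hint : IntervalIntegrable (fun θ => g (circleMap 0 r θ)) volume (-π) π := by
    -- Circle averages run over [0, 2π], polar coordinates over (-π, π).
    have hp : Function.Periodic (fun θ => g (circleMap 0 r θ)) (2 * π) := fun θ => by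
      simp [periodic_circleMap 0 r θ]
    have := hp.intervalIntegrable₀ (by positivity) hg
    exact this (-π) π
  have hI : ∫ θ in Set.Ioo (-π) π, g (circleMap 0 r θ) = 2 * π * circleAverage g 0 r := by
    rw [← integral_Ioc_eq_integral_Ioo, ← intervalIntegral.integral_of_le (by linarith [pi_pos]),
      circleAverage_eq_integral_add (-π), intervalIntegral.integral_comp_add_right
        (fun θ => g (circleMap 0 r θ))]
    simp only [zero_add, smul_eq_mul]
    rw [show 2 * π + -π = π by ring]
    field_simp
  rw [lintegral_const_mul' _ _ ENNReal.ofReal_ne_top, ← ofReal_integral_eq_lintegral_ofReal,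
    hI, ← ENNReal.ofReal_mul hr]
  · congr 1; ring
  · exact (intervalIntegrable_iff_integrableOn_Ioo_of_le (by linarith [pi_pos])).1 hint
  · exact Eventually.of_forall fun θ => hg0 _

/-- Polar coordinates on an annulus. -/
lemma lintegral_annulus {g : ℂ → ℝ} (hgm : Measurable g) (hg0 : ∀ z, 0 ≤ g z)
    (hg : ∀ r, CircleIntegrable g 0 r) {a b : ℝ} (ha : 0 ≤ a) :
    ∫⁻ z in {z : ℂ | a < ‖z‖ ∧ ‖z‖ < b}, ENNReal.ofReal (g z) =
      ∫⁻ r in Set.Ioo a b, ENNReal.ofReal (2 * π * r * circleAverage g 0 r) := by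
  have hS : MeasurableSet {z : ℂ | a < ‖z‖ ∧ ‖z‖ < b} :=
    (measurableSet_lt measurable_const measurable_norm).inter
      (measurableSet_lt measurable_norm measurable_const)
  rw [← lintegral_indicator hS, lintegral_complex_polar (hgm.ennreal_ofReal.indicator hS),
    ← lintegral_indicator measurableSet_Ioo, ← lintegral_indicator measurableSet_Ioi]
  refine lintegral_congr fun r => ?_
  by_cases h0 : 0 < r
  · rw [Set.indicator_of_mem (Set.mem_Ioi.2 h0)]
    by_cases hr : r ∈ Set.Ioo a b
    · rw [Set.indicator_of_mem hr, ← lintegral_circle hg0 h0.le (hg r)]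
      refine lintegral_congr fun θ => ?_
      rw [Set.indicator_of_mem]
      simpa [abs_of_pos h0] using hr
    · rw [Set.indicator_of_notMem hr]
      refine (lintegral_congr fun θ => ?_).trans lintegral_zero
      rw [Set.indicator_of_notMem, mul_zero]
      simpa [abs_of_pos h0] using hr
  · rw [Set.indicator_of_notMem (by simpa using h0), Set.indicator_of_notMem]
    exact fun h => h0 (ha.trans_lt h.1)

/-- Circle means about 0 become area integrals because the latter, unlike the former, can be
translated. -/
lemma lintegral_annulus_le {g : ℂ → ℝ} (hgm : Measurable g) (hg0 : ∀ z, 0 ≤ g z)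
    (hg : ∀ r, CircleIntegrable g 0 r) {a b X : ℝ} (ha : 0 ≤ a) (hab : a ≤ b) (hX0 : 0 ≤ X)
    (hX : ∀ r ∈ Set.Ioo a b, circleAverage g 0 r ≤ X) :
    ∫⁻ z in {z : ℂ | a < ‖z‖ ∧ ‖z‖ < b}, ENNReal.ofReal (g z) ≤
      ENNReal.ofReal (2 * π * b * X * (b - a)) := by
  rw [lintegral_annulus hgm hg0 hg ha]
  calc _ ≤ ∫⁻ r in Set.Ioo a b, ENNReal.ofReal (2 * π * b * X) := by
        refine setLIntegral_mono measurable_const fun r hr => ENNReal.ofReal_le_ofReal ?_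
        have := hX r hr
        have hr0 : 0 < r := ha.trans_lt hr.1
        have hrb := hr.2.le
        calc 2 * π * r * circleAverage g 0 r ≤ 2 * π * r * X := by gcongr
          _ ≤ 2 * π * b * X := by gcongr
    _ = _ := by
        rw [setLIntegral_const, Real.volume_Ioo, ← ENNReal.ofReal_mul]
        have := ha.trans hab
        positivity

lemma le_lintegral_annulus {g : ℂ → ℝ} (hgm : Measurable g) (hg0 : ∀ z, 0 ≤ g z)
    (hg : ∀ r, CircleIntegrable g 0 r) {a b Y : ℝ} (ha : 0 ≤ a) (hY0 : 0 ≤ Y)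
    (hY : ∀ r ∈ Set.Ioo a b, Y ≤ circleAverage g 0 r) :
    ENNReal.ofReal (2 * π * a * Y * (b - a)) ≤
    ∫⁻ z in {z : ℂ | a < ‖z‖ ∧ ‖z‖ < b}, ENNReal.ofReal (g z) := by
  rw [lintegral_annulus hgm hg0 hg ha]
  calc _ = ∫⁻ r in Set.Ioo a b, ENNReal.ofReal (2 * π * a * Y) := by
        rw [setLIntegral_const, Real.volume_Ioo, ← ENNReal.ofReal_mul]
        positivity
    _ ≤ _ := by
        refine setLIntegral_mono' measurableSet_Ioo fun r hr => ENNReal.ofReal_le_ofReal ?_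
        have := hY r hr
        have hr0 : 0 < r := ha.trans_lt hr.1
        have hra := hr.1.le
        calc 2 * π * a * Y ≤ 2 * π * r * Y := by gcongr
          _ ≤ _ := by gcongr

/-- Jensen's inequality: `log ‖f‖` is subharmonic for entire `f`. -/
lemma log_norm_le_circleAverage {f : ℂ → ℂ} (hf : Differentiable ℂ f) {z : ℂ} (hz : f z ≠ 0)
    {r : ℝ} (hr : 0 < r) : log ‖f z‖ ≤ circleAverage (fun w => log⁺ ‖f w‖) z r := by
  have han : AnalyticOnNhd ℂ f (Metric.closedBall z |r|) := fun w _ => hf.analyticAt w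
  have h := AnalyticOnNhd.circleAverage_log_norm hr.ne' han hz
  have hnn : 0 ≤ ∑ᶠ u, (MeromorphicOn.divisor f (Metric.closedBall z |r|) u : ℝ) *
      log (r * ‖z - u‖⁻¹) := by
    refine finsum_nonneg fun u => ?_
    by_cases hu : u ∈ Metric.closedBall z |r|
    · refine mul_nonneg (by exact_mod_cast (MeromorphicOn.AnalyticOnNhd.divisor_nonneg han) u) ?_
      rcases eq_or_ne z u with rfl | hne
      -- Here the logarithm is log (r * 0⁻¹) = log 0 = 0.
      · simp
      · have hpos : 0 < ‖z - u‖ := norm_pos_iff.2 (sub_ne_zero.2 hne)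
        refine log_nonneg ?_
        rw [← div_eq_mul_inv, one_le_div hpos]
        rw [Metric.mem_closedBall, dist_comm, dist_eq_norm, abs_of_pos hr] at hu
        exact hu
    · simp [hu]
  calc log ‖f z‖ ≤ circleAverage (fun w => log ‖f w‖) z r := by rw [h]; linarith
    _ ≤ _ := by
      refine circleAverage_mono (MeromorphicOn.circleIntegrable_log_norm fun w _ =>
        (hf.analyticAt w).meromorphicAt) ?_ ?_
      · refine MeromorphicOn.circleIntegrable_posLog_norm fun w _ => (hf.analyticAt w).meromorphicAt
      · intro w _
        rw [posLog_apply]; exact le_max_right _ _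

lemma measurable_posLog_norm {f : ℂ → ℂ} (hf : Measurable f) :
    Measurable fun w => log⁺ ‖f w‖ :=
  continuous_posLog.measurable.comp hf.norm

/-- Integrals of `log⁺ ‖f‖` over translated annuli are controlled by the proximity function. -/
lemma lintegral_posLog_translate_le {f : ℂ → ℂ} (hf : Meromorphic f) {z : ℂ} {R X : ℝ}
    (hz1 : 3 / 2 * R ≤ ‖z‖) (hz2 : ‖z‖ ≤ 3 * R) (hX0 : 0 ≤ X)
    (hX : ∀ s ∈ Set.Ioo (R / 2) (4 * R), proximity f ⊤ s ≤ X) :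
    ∫⁻ w in {w : ℂ | R / 2 < ‖w‖ ∧ ‖w‖ < R}, ENNReal.ofReal (log⁺ ‖f (z + w)‖) ≤
      ENNReal.ofReal (28 * π * R ^ 2 * X) := by
  have hR : 0 ≤ R := by linarith
  have hS (a b : ℝ) : MeasurableSet {z : ℂ | a < ‖z‖ ∧ ‖z‖ < b} :=
    (measurableSet_lt measurable_const measurable_norm).inter
      (measurableSet_lt measurable_norm measurable_const)
  calc ∫⁻ w in {w : ℂ | R / 2 < ‖w‖ ∧ ‖w‖ < R}, ENNReal.ofReal (log⁺ ‖f (z + w)‖)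
      ≤ ∫⁻ w, {u : ℂ | R / 2 < ‖u‖ ∧ ‖u‖ < 4 * R}.indicator
          (fun u => ENNReal.ofReal (log⁺ ‖f u‖)) (z + w) := by
        rw [← lintegral_indicator (hS _ _)]
        refine lintegral_mono fun w => ?_
        by_cases hw : w ∈ {w : ℂ | R / 2 < ‖w‖ ∧ ‖w‖ < R}
        · rw [Set.indicator_of_mem hw, Set.indicator_of_mem]
          have h1 := norm_add_le z w
          have h2 := norm_sub_norm_le z (-w)
          rw [sub_neg_eq_add, norm_neg] at h2
          have h3 : ‖w‖ < R := hw.2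
          constructor <;> linarith
        · rw [Set.indicator_of_notMem hw]; exact zero_le
    _ = ∫⁻ u in {u : ℂ | R / 2 < ‖u‖ ∧ ‖u‖ < 4 * R}, ENNReal.ofReal (log⁺ ‖f u‖) := by
        rw [lintegral_add_left_eq_self, lintegral_indicator (hS _ _)]
    _ ≤ ENNReal.ofReal (2 * π * (4 * R) * X * (4 * R - R / 2)) := by
        refine lintegral_annulus_le (measurable_posLog_norm hf.measurable)
          (fun _ => posLog_nonneg) (fun r => hf.meromorphicOn.circleIntegrable_posLog_norm)
          (by linarith) (by linarith) hX0 fun r hr => ?_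
        have := hX r hr
        rwa [proximity_top] at this
    _ = _ := by congr 1; ring

/-- The integral of log⁺|A(z + w)| over R/2 < |w| < R is at least (πR²/2) log|A(z)| by
subharmonicity, and at most πR²D plus 28πR²X for each F_i; dividing gives the constants 2 and 56. -/
theorem log_norm_le_of_ae_posLog_le {A : ℂ → ℂ} (hA : Differentiable ℂ A) {z : ℂ} {R : ℝ}
    (hR : 0 < R) (hz : ‖z‖ = 2 * R) (hAz : A z ≠ 0) {ι : Type*} [Fintype ι] {F : ι → ℂ → ℂ}
    (hF : ∀ i, Meromorphic (F i)) {c : ι → ℂ} (hc : ∀ i, ‖c i‖ ≤ R / 2) {D X : ℝ} (hD : 0 ≤ D)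
    (hX0 : 0 ≤ X) (hX : ∀ i, ∀ s ∈ Set.Ioo (R / 2) (4 * R), proximity (F i) ⊤ s ≤ X)
    (hae : ∀ᵐ w : ℂ, ‖w‖ < 3 * R → log⁺ ‖A w‖ ≤ D + ∑ i, log⁺ ‖F i (w + c i)‖) :
    log ‖A z‖ ≤ 2 * D + 56 * Fintype.card ι * X := by
  have hrhs : 0 ≤ 2 * D + 56 * Fintype.card ι * X := by positivity
  rcases le_or_gt (log ‖A z‖) 0 with hneg | hpos
  · exact hneg.trans hrhs
  have hAt : Differentiable ℂ fun w => A (z + w) := by fun_prop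
  have hlow : ENNReal.ofReal (2 * π * (R / 2) * log ‖A z‖ * (R - R / 2)) ≤
      ∫⁻ w in {w : ℂ | R / 2 < ‖w‖ ∧ ‖w‖ < R}, ENNReal.ofReal (log⁺ ‖A (z + w)‖) := by
    refine le_lintegral_annulus (measurable_posLog_norm hAt.continuous.measurable)
      (fun _ => posLog_nonneg) (fun r => MeromorphicOn.circleIntegrable_posLog_norm
        fun w _ => (hAt.analyticAt w).meromorphicAt) (by positivity) hpos.le fun r hr => ?_
    have hr0 : 0 < r := (by positivity : (0 : ℝ) < R / 2).trans hr.1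
    have := log_norm_le_circleAverage (z := 0) hAt (by simpa using hAz) hr0
    simpa using this
  have hae' : ∀ᵐ w : ℂ, ‖z + w‖ < 3 * R →
      log⁺ ‖A (z + w)‖ ≤ D + ∑ i, log⁺ ‖F i (z + w + c i)‖ :=
    (measurePreserving_add_left volume z).quasiMeasurePreserving.ae hae
  have hS : MeasurableSet {z : ℂ | R / 2 < ‖z‖ ∧ ‖z‖ < R} :=
    (measurableSet_lt measurable_const measurable_norm).inter
      (measurableSet_lt measurable_norm measurable_const)
  have hup : ∫⁻ w in {w : ℂ | R / 2 < ‖w‖ ∧ ‖w‖ < R}, ENNReal.ofReal (log⁺ ‖A (z + w)‖) ≤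
      ENNReal.ofReal (π * R ^ 2 * D + Fintype.card ι * (28 * π * R ^ 2 * X)) := by
    calc _ ≤ ∫⁻ w in {w : ℂ | R / 2 < ‖w‖ ∧ ‖w‖ < R},
          (ENNReal.ofReal D + ∑ i, ENNReal.ofReal (log⁺ ‖F i (z + c i + w)‖)) := by
          refine lintegral_mono_ae ?_
          filter_upwards [ae_restrict_of_ae hae', ae_restrict_mem hS] with w h1 h2
          have h3 : ‖z + w‖ < 3 * R := (norm_add_le z w).trans_lt (by linarith [h2.2])
          rw [← ENNReal.ofReal_sum_of_nonneg fun _ _ => posLog_nonneg,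
            ← ENNReal.ofReal_add hD (Finset.sum_nonneg fun _ _ => posLog_nonneg)]
          refine ENNReal.ofReal_le_ofReal ((h1 h3).trans_eq ?_)
          simp only [add_right_comm]
      _ = (∫⁻ w in {w : ℂ | R / 2 < ‖w‖ ∧ ‖w‖ < R}, ENNReal.ofReal D) +
          ∑ i, ∫⁻ w in {w : ℂ | R / 2 < ‖w‖ ∧ ‖w‖ < R},
            ENNReal.ofReal (log⁺ ‖F i (z + c i + w)‖) := by
          rw [lintegral_add_left measurable_const, lintegral_finsetSum]
          intro i _
          exact (measurable_posLog_norm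
            ((hF i).measurable.comp (measurable_const_add _))).ennreal_ofReal
      _ ≤ ENNReal.ofReal (2 * π * R * D * (R - R / 2)) +
          ∑ i : ι, ENNReal.ofReal (28 * π * R ^ 2 * X) := by
          gcongr with i
          · refine lintegral_annulus_le (g := fun _ => D) measurable_const (fun _ => hD)
              (fun r => circleIntegrable_const _ _ _) (by positivity) (by linarith) hD
              fun r _ => ?_
            rw [circleAverage_const]
          · have h1 := norm_add_le z (c i)
            have h2 := norm_sub_norm_le z (-c i)
            rw [sub_neg_eq_add, norm_neg] at h2
            have h3 := hc i
            exact lintegral_posLog_translate_le (hF i) (by linarith) (by linarith) hX0 (hX i)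
      _ = _ := by
          rw [← ENNReal.ofReal_sum_of_nonneg fun _ _ => by positivity, ← ENNReal.ofReal_add]
          · congr 1
            simp
            ring
          · have : 0 ≤ R - R / 2 := by linarith
            positivity
          · exact Finset.sum_nonneg fun _ _ => by positivity
  have hfin := (ENNReal.ofReal_le_ofReal_iff (by positivity)).1 (hlow.trans hup)
  have hk : 0 < π * R ^ 2 / 2 := by positivity
  refine le_of_mul_le_mul_left ?_ hk
  linarith

/-! ### The pointwise bound from the equation -/

/-- In a vanishing sum `∑ a i * y i = 0` with nonzero `y i` each `a l` is controlled by the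
other `a j` and by the `y j` and their inverses. -/
lemma posLog_norm_le_of_sum_mul_eq_zero {n : ℕ} {a y : Fin n → ℂ} (hy : ∀ i, y i ≠ 0)
    (h : ∑ i, a i * y i = 0) (l : Fin n) :
    log⁺ ‖a l‖ ≤ log n + (∑ j ∈ Finset.univ.erase l, log⁺ ‖a j‖) +
      ∑ i, (log⁺ ‖y i‖ + log⁺ ‖(y i)⁻¹‖) := by
  have h1 : a l = (y l)⁻¹ * -∑ j ∈ Finset.univ.erase l, a j * y j := by
    rw [← Finset.add_sum_erase _ _ (Finset.mem_univ l)] at h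
    rw [← eq_neg_of_add_eq_zero_left h]
    field_simp [hy l]
  have h2 : log⁺ ‖a l‖ ≤ log⁺ ‖(y l)⁻¹‖ + log⁺ ‖∑ j ∈ Finset.univ.erase l, a j * y j‖ := by
    conv_lhs => rw [h1, norm_mul, norm_neg]
    exact posLog_mul
  have h3 := posLog_norm_sum_le (Finset.univ.erase l) fun j => a j * y j
  have h4 : log ((Finset.univ.erase l).card : ℝ) ≤ log n := by
    rw [Finset.card_erase_of_mem (Finset.mem_univ l), Finset.card_fin]
    rcases Nat.eq_zero_or_pos (n - 1) with h0 | h0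
    · rw [h0]
      simpa using log_natCast_nonneg n
    · exact log_le_log (by exact_mod_cast h0) (by exact_mod_cast Nat.sub_le n 1)
  have h5 : ∑ j ∈ Finset.univ.erase l, log⁺ ‖a j * y j‖ ≤
      (∑ j ∈ Finset.univ.erase l, log⁺ ‖a j‖) + ∑ j ∈ Finset.univ.erase l, log⁺ ‖y j‖ := by
    rw [← Finset.sum_add_distrib]
    refine Finset.sum_le_sum fun j _ => ?_
    rw [norm_mul]
    exact posLog_mul
  have h6 : ∑ j ∈ Finset.univ.erase l, log⁺ ‖y j‖ ≤ ∑ j, log⁺ ‖y j‖ :=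
    Finset.sum_le_sum_of_subset_of_nonneg (Finset.erase_subset _ _) fun _ _ _ => posLog_nonneg
  have h7 : log⁺ ‖(y l)⁻¹‖ ≤ ∑ j, log⁺ ‖(y j)⁻¹‖ :=
    Finset.single_le_sum (f := fun j => log⁺ ‖(y j)⁻¹‖) (fun _ _ => posLog_nonneg)
      (Finset.mem_univ l)
  rw [Finset.sum_add_distrib]
  linarith

lemma ae_of_codiscrete {s : ℂ → Prop} (h : ∀ᶠ z in codiscrete ℂ, s z) : ∀ᵐ z : ℂ, s z := by
  have hc : {z | s z}ᶜ.Countable :=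
    (HereditarilyLindelofSpace.isLindelof _).countable_of_isDiscrete (mem_codiscrete'.1 h).2
  exact mem_ae_iff.2 (hc.measure_zero volume)

/-- Identity principle: infinite order at one point spreads over the connected plane. -/
lemma Meromorphic.eventually_codiscrete_ne_zero {f : ℂ → ℂ} (hf : Meromorphic f)
    (hf0 : ¬ f =ᶠ[codiscrete ℂ] 0) : ∀ᶠ z in codiscrete ℂ, f z ≠ 0 := by
  refine MeromorphicOn.eventually_codiscreteWithin_apply_ne_zero hf.meromorphicOn fun x _ hx =>
    hf0 ?_
  have htop : ∀ z, meromorphicOrderAt f z = ⊤ := fun z => by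
    by_contra hz
    exact MeromorphicOn.meromorphicOrderAt_ne_top_of_isPreconnected hf.meromorphicOn
      isPreconnected_univ (Set.mem_univ z) (Set.mem_univ x) hz hx
  rw [EventuallyEq, Filter.Eventually, mem_codiscrete]
  intro z
  rw [disjoint_principal_right, compl_compl]
  exact meromorphicOrderAt_eq_top_iff.1 (htop z)

lemma ae_posLog_norm_le_of_isMeromorphicSolution {k : ℕ} {A : Fin (k + 2) → ℂ → ℂ}
    {c : Fin k → ℂ} {f : ℂ → ℂ} (hf : IsMeromorphicSolution A c f)
    (hf0 : ¬ f =ᶠ[codiscrete ℂ] 0) (l : Fin (k + 2)) :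
    ∀ᵐ z : ℂ, log⁺ ‖A l z‖ ≤ log (k + 2) + (∑ j ∈ Finset.univ.erase l, log⁺ ‖A j z‖) +
      ∑ i : Fin (k + 1), (log⁺ ‖f (z + Fin.cons (α := fun _ => ℂ) 0 c i)‖ +
        log⁺ ‖(f (z + Fin.cons (α := fun _ => ℂ) 0 c i))⁻¹‖) := by
  have hne : ∀ i : Fin (k + 1), ∀ᵐ z : ℂ, f (z + Fin.cons (α := fun _ => ℂ) 0 c i) ≠ 0 :=
    fun i => (measurePreserving_add_right volume _).quasiMeasurePreserving.ae
      (ae_of_codiscrete (hf.1.eventually_codiscrete_ne_zero hf0))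
  filter_upwards [ae_of_codiscrete hf.2, ae_all_iff.2 hne] with z hz hnz
  -- The multiplier -1 of A_{k+1} treats homogeneous and inhomogeneous equations alike, and
  -- contributes log⁺ 1 = 0 to the bound.
  set y : Fin (k + 2) → ℂ :=
    Fin.snoc (α := fun _ => ℂ) (fun i => f (z + Fin.cons (α := fun _ => ℂ) 0 c i)) (-1) with hy
  have h1 : ∀ i, y i ≠ 0 := by
    intro i
    refine Fin.lastCases ?_ (fun i => ?_) i
    · simp [hy]
    · simpa [hy] using hnz i
  have h2 : ∑ i, A i z * y i = 0 := by
    rw [Fin.sum_univ_castSucc]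
    simp only [hy, Fin.snoc_castSucc, Fin.snoc_last]
    rw [Fin.sum_univ_succ]
    simp only [Fin.cons_zero, Fin.cons_succ, add_zero, Fin.castSucc_zero]
    rw [hz]; ring
  have h3 := posLog_norm_le_of_sum_mul_eq_zero h1 h2 l
  rw [Fin.sum_univ_castSucc (f := fun i => log⁺ ‖y i‖ + log⁺ ‖(y i)⁻¹‖)] at h3
  simpa [hy] using h3

/-! ### A dominant coefficient forces growth of the solution -/

lemma proximity_top_le_characteristic {f : ℂ → ℂ} {r : ℝ} (hr : 1 ≤ r) :
    proximity f ⊤ r ≤ characteristic f ⊤ r :=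
  le_add_of_nonneg_right (logCounting_nonneg hr)

/-- A coefficient that outgrows all the others (one of them only along a sequence) outgrows the
characteristic of every solution. -/
theorem frequently_characteristic_gt_of_dominant_coefficient {k n e : ℕ} (hn : 1 ≤ n) (he : 1 ≤ e)
    {A : Fin (k + 2) → ℂ → ℂ} (hA : ∀ j, Differentiable ℂ (A j)) {c : Fin k → ℂ} {f : ℂ → ℂ}
    (hf : IsMeromorphicSolution A c f) (hf0 : ¬ f =ᶠ[codiscrete ℂ] 0) {l m : Fin (k + 2)}
    {ν a b : ℝ} (hν : 0 < ν) (ha : 0 < a) (hab : a < b)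
    (hl : Tendsto (maxModulus (A l)) atTop atTop)
    (hlb : ∀ᶠ r in atTop, b * iterLog e r ^ ν ≤ iterLog (n + 1) (maxModulus (A l) r))
    (hj : ∀ j, j ≠ m ∧ j ≠ l →
      ∀ᶠ r in atTop, iterLog (n + 1) (maxModulus (A j) r) ≤ a * iterLog e r ^ ν)
    (hm : ∃ᶠ r in atTop, iterLog (n + 1) (maxModulus (A m) r) ≤ a * iterLog e r ^ ν) :
    ∃ᶠ r in atTop, a * iterLog e r ^ ν < iterLog n (characteristic f ⊤ r) := by
  by_contra hT
  simp only [not_frequently, not_lt] at hT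
  -- Passing from a to a' pays for the dilation from 2r/3 to 4r/3, passing from a' to b for the
  -- factor C.
  obtain ⟨a', haa', ha'b⟩ := exists_between hab
  have ha' : 0 < a' := ha.trans haa'
  -- Bounds |T(s, f) - T(s, 1/f)|, by the first main theorem.
  set K : ℝ := max |log ‖f 0‖| |log ‖meromorphicTrailingCoeffAt f 0‖| with hK
  have hK0 : 0 ≤ K := (abs_nonneg _).trans (le_max_left _ _)
  set C : ℝ := 2 * (log (k + 2) + (k + 2)) + 56 * (2 * (k + 1)) * (1 + K) with hC
  -- With R = r/3, the maximum point has modulus 2R = 2r/3, the coefficients are needed on |w| < 3R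
  -- = r, and T on (R/2, 4R) = (r/6, 4r/3).
  have t2 : Tendsto (fun r : ℝ => 2 / 3 * r) atTop atTop :=
    tendsto_id.const_mul_atTop (by norm_num)
  have t6 : Tendsto (fun r : ℝ => 1 / 6 * r) atTop atTop :=
    tendsto_id.const_mul_atTop (by norm_num)
  have hx : Tendsto (fun r : ℝ => iterLog e (2 / 3 * r) ^ ν) atTop atTop :=
    (tendsto_rpow_atTop hν).comp ((tendsto_iterLog e).comp t2)
  have ev1 := t2.eventually hlb
  have ev2 := (hl.comp t2).eventually (eventually_exp_iterate_le_of_le_iterLog (n + 1))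
  have ev3 : ∀ᶠ r in atTop, ∀ j, j ≠ m ∧ j ≠ l →
      iterLog (n + 1) (maxModulus (A j) r) ≤ a * iterLog e r ^ ν :=
    eventually_all.2 fun j => by
      by_cases h : j ≠ m ∧ j ≠ l
      · filter_upwards [hj j h] with r hr _ using hr
      · exact Eventually.of_forall fun r h' => absurd h' h
  have ev4 := t6.eventually (eventually_forall_ge_atTop.2
    (hT.and ((eventually_iterLog_le_iterLog e).and ((tendsto_iterLog e).eventually_ge_atTop 0))))
  have ev5 := t2.eventually (eventually_mul_iterLog_rpow_le ha haa' two_pos hν he)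
  have ev6 := hx.eventually (eventually_mul_exp_iterate_lt ha' ha'b hn C)
  have ev7 := ((tendsto_exp_iterate n).comp (hx.const_mul_atTop ha')).eventually_ge_atTop 1
  have ev8 : ∀ᶠ r in atTop, ∀ i, ‖Fin.cons (α := fun _ => ℂ) 0 c i‖ ≤ 1 / 6 * r :=
    eventually_all.2 fun i => t6.eventually_ge_atTop _
  obtain ⟨r, hrm, hr0, hr1, hr2, hr3, hr4, hr5, hr6, hr7, hr8⟩ :=
    (hm.and_eventually ((t6.eventually_ge_atTop 1).and (ev1.and (ev2.and (ev3.and (ev4.and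
      (ev5.and (ev6.and (ev7.and ev8))))))))).exists
  set G : ℝ := Real.exp^[n] (a' * iterLog e (2 / 3 * r) ^ ν) with hG
  have hG1 : 1 ≤ G := hr7
  have hbound : ∀ s, 1 / 6 * r ≤ s → s ≤ 4 / 3 * r → Real.exp^[n] (a * iterLog e s ^ ν) ≤ G := by
    intro s hs1 hs2
    obtain ⟨-, h2, h3⟩ := hr4 s hs1
    have h4 : iterLog e s ≤ iterLog e (2 * (2 / 3 * r)) := h2 _ (by linarith)
    refine monotone_exp_iterate n (le_trans ?_ hr5)
    gcongr
  have hchar : ∀ s, 1 / 6 * r ≤ s → s ≤ 4 / 3 * r → characteristic f ⊤ s ≤ G := fun s hs1 hs2 =>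
    (le_exp_iterate_of_iterLog_le (hr4 s hs1).1).trans (hbound s hs1 hs2)
  have hcoef : ∀ j, j ≠ l → ∀ w, ‖w‖ ≤ r → log⁺ ‖A j w‖ ≤ G := by
    intro j hjl w hw
    have h1 : iterLog (n + 1) (maxModulus (A j) r) ≤ a * iterLog e r ^ ν := by
      by_cases hjm : j = m
      · rw [hjm]; exact hrm
      · exact hr3 j ⟨hjm, hjl⟩
    have h2 := le_exp_iterate_of_iterLog_le h1
    rw [Function.iterate_succ_apply'] at h2
    have h3 : ‖A j w‖ ≤ Real.exp G := (norm_le_maxModulus (hA j) hw).trans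
      (h2.trans (Real.exp_le_exp.2 (hbound r (by linarith) (by linarith))))
    refine (posLog_le_posLog (norm_nonneg _) h3).trans_eq ?_
    rw [posLog_apply, Real.log_exp, max_eq_right (by linarith)]
  obtain ⟨z, hz, hzM⟩ := exists_norm_eq_maxModulus (hA l).continuous
    (r := 2 / 3 * r) (by linarith)
  have hlow : Real.exp (Real.exp^[n] (b * iterLog e (2 / 3 * r) ^ ν)) ≤ ‖A l z‖ := by
    rw [hzM, ← Function.iterate_succ_apply' Real.exp]
    exact hr2 _ hr1
  have hAz : A l z ≠ 0 := norm_pos_iff.1 ((Real.exp_pos _).trans_le hlow)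
  have hlogk : 0 ≤ log ((k : ℝ) + 2) := log_nonneg (by linarith [(Nat.cast_nonneg k : (0 : ℝ) ≤ k)])
  have hup : log ‖A l z‖ ≤ 2 * (log (k + 2) + (k + 2) * G) +
      56 * Fintype.card (Fin (k + 1) ⊕ Fin (k + 1)) * (G + K) := by
    refine log_norm_le_of_ae_posLog_le (hA l) (R := 1 / 3 * r) (by linarith) (by rw [hz]; ring) hAz
      (F := Sum.elim (fun _ => f) (fun _ => f⁻¹))
      (c := Sum.elim (Fin.cons (α := fun _ => ℂ) 0 c) (Fin.cons (α := fun _ => ℂ) 0 c))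
      ?_ ?_ (by positivity) (by positivity) ?_ ?_
    · rintro (i | i)
      · exact hf.1
      · exact hf.1.inv
    · rintro (i | i) <;> exact (hr8 i).trans_eq (by ring)
    · rintro i s ⟨hs1, hs2⟩
      have h1 := hchar s (by linarith) (by linarith)
      have hs : 1 ≤ s := by linarith
      rcases i with i | i
      · exact (proximity_top_le_characteristic hs).trans (h1.trans (by linarith))
      · have h2 := abs_le.1 (characteristic_sub_characteristic_inv_le hf.1 (R := s))
        exact (proximity_top_le_characteristic (f := f⁻¹) hs).trans (by linarith [h2.1])
    · filter_upwards [ae_posLog_norm_le_of_isMeromorphicSolution hf hf0 l] with w hw hwr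
      have h1 : ∑ j ∈ Finset.univ.erase l, log⁺ ‖A j w‖ ≤ (k + 2) * G := by
        calc _ ≤ ∑ j ∈ Finset.univ.erase l, G :=
              Finset.sum_le_sum fun j hj => hcoef j (Finset.ne_of_mem_erase hj) w (by linarith)
          _ ≤ ∑ j : Fin (k + 2), G :=
              Finset.sum_le_sum_of_subset_of_nonneg (Finset.erase_subset _ _)
                fun _ _ _ => by linarith
          _ = _ := by simp
      rw [Fintype.sum_sum_type]
      simp only [Sum.elim_inl, Sum.elim_inr, Pi.inv_apply]
      rw [Finset.sum_add_distrib] at hw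
      linarith
  have hfin : log ‖A l z‖ ≤ C * G := by
    refine hup.trans ?_
    simp only [Fintype.card_sum, Fintype.card_fin, Nat.cast_add, Nat.cast_one, hC]
    have h1 : log ((k : ℝ) + 2) ≤ log (k + 2) * G := le_mul_of_one_le_right hlogk hG1
    have h2 : G + K ≤ (1 + K) * G := by nlinarith
    have h3 : 56 * ((k : ℝ) + 1 + (k + 1)) * (G + K) ≤
        56 * ((k : ℝ) + 1 + (k + 1)) * ((1 + K) * G) := by gcongr
    nlinarith
  have hge := (Real.le_log_iff_exp_le (norm_pos_iff.2 hAz)).2 hlow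
  exact absurd (hr6.trans_le hge) (not_lt.2 hfin)

/-! ### From orders and types to growth bounds -/

section Growth

variable {n e : ℕ} {f : ℂ → ℂ}

lemma eventually_le_of_order_lt {β : ℝ} (h : entirePQOrder (n + 1) (e + 1) f < β) :
    ∀ᶠ r in atTop, iterLog (n + 1) (maxModulus f r) ≤ iterLog e r ^ β := by
  filter_upwards [eventually_lt_of_limsup_lt h (by isBoundedDefault),
    (tendsto_iterLog e).eventually_gt_atTop 1] with r h1 h2
  exact iterLog_le_rpow_of_div_lt h2 (EReal.coe_lt_coe_iff.1 h1)

lemma frequently_le_of_lowerOrder_lt {β : ℝ} (h : entirePQLowerOrder (n + 1) (e + 1) f < β) :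
    ∃ᶠ r in atTop, iterLog (n + 1) (maxModulus f r) ≤ iterLog e r ^ β :=
  ((frequently_lt_of_liminf_lt (by isBoundedDefault) h).and_eventually
    ((tendsto_iterLog e).eventually_gt_atTop 1)).mono fun r hr =>
      iterLog_le_rpow_of_div_lt hr.2 (EReal.coe_lt_coe_iff.1 hr.1)

lemma eventually_le_of_lt_lowerOrder {β : ℝ} (hf : Tendsto (maxModulus f) atTop atTop)
    (h : β < entirePQLowerOrder (n + 1) (e + 1) f) :
    ∀ᶠ r in atTop, iterLog e r ^ β ≤ iterLog (n + 1) (maxModulus f r) := by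
  filter_upwards [eventually_lt_of_lt_liminf h (by isBoundedDefault),
    (tendsto_iterLog e).eventually_gt_atTop 1,
    ((tendsto_iterLog (n + 1)).comp hf).eventually_gt_atTop 0] with r h1 h2 h3
  exact rpow_le_iterLog_of_lt_div h2 h3 (EReal.coe_lt_coe_iff.1 h1)

lemma eventually_le_of_meromorphicOrder_lt {β : ℝ}
    (h : meromorphicPQOrder (n + 1) (e + 1) f < β) :
    ∀ᶠ r in atTop, iterLog n (characteristic f ⊤ r) ≤ iterLog e r ^ β := by
  filter_upwards [eventually_lt_of_limsup_lt h (by isBoundedDefault),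
    (tendsto_iterLog e).eventually_gt_atTop 1] with r h1 h2
  exact iterLog_le_rpow_of_div_lt h2 (EReal.coe_lt_coe_iff.1 h1)

lemma eventually_le_of_type_lt {μ a : ℝ} (hμ : entirePQOrder (n + 1) (e + 1) f = μ)
    (h : entirePQType (n + 1) (e + 1) f < a) :
    ∀ᶠ r in atTop, iterLog (n + 1) (maxModulus f r) ≤ a * iterLog e r ^ μ := by
  rw [entirePQType, hμ] at h
  filter_upwards [eventually_lt_of_limsup_lt h (by isBoundedDefault),
    (tendsto_iterLog e).eventually_gt_atTop 0] with r h1 h2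
  exact ((div_lt_iff₀ (Real.rpow_pos_of_pos h2 _)).1 (EReal.coe_lt_coe_iff.1 h1)).le

lemma frequently_le_of_lowerType_lt {μ a : ℝ} (hμ : entirePQLowerOrder (n + 1) (e + 1) f = μ)
    (h : entirePQLowerType (n + 1) (e + 1) f < a) :
    ∃ᶠ r in atTop, iterLog (n + 1) (maxModulus f r) ≤ a * iterLog e r ^ μ := by
  rw [entirePQLowerType, hμ] at h
  exact ((frequently_lt_of_liminf_lt (by isBoundedDefault) h).and_eventually
    ((tendsto_iterLog e).eventually_gt_atTop 0)).mono fun r hr =>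
      ((div_lt_iff₀ (Real.rpow_pos_of_pos hr.2 _)).1 (EReal.coe_lt_coe_iff.1 hr.1)).le

lemma eventually_le_of_lt_lowerType {μ b : ℝ} (hμ : entirePQLowerOrder (n + 1) (e + 1) f = μ)
    (h : b < entirePQLowerType (n + 1) (e + 1) f) :
    ∀ᶠ r in atTop, b * iterLog e r ^ μ ≤ iterLog (n + 1) (maxModulus f r) := by
  rw [entirePQLowerType, hμ] at h
  filter_upwards [eventually_lt_of_lt_liminf h (by isBoundedDefault),
    (tendsto_iterLog e).eventually_gt_atTop 0] with r h1 h2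
  exact ((lt_div_iff₀ (Real.rpow_pos_of_pos h2 _)).1 (EReal.coe_lt_coe_iff.1 h1)).le

end Growth

/-- A finite supremum above ⊥ is attained. This guards against an empty family of types, whose
supremum would be ⊥ rather than nonnegative. -/
lemma exists_eq_of_iSup_eq {ι : Type*} [Finite ι] {P : ι → Prop} {g : ι → EReal} {μ : EReal}
    (hμ : ⊥ < μ) (h : ⨆ i, ⨆ _ : P i, g i = μ) : ∃ i, P i ∧ g i = μ := by
  classical
  have := Fintype.ofFinite ι
  by_contra! hne
  have h1 : (Finset.univ.filter P).sup g < μ := by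
    refine (Finset.sup_lt_iff hμ).2 fun i hi => ?_
    have hi' : P i := by simpa using hi
    exact lt_of_le_of_ne (h ▸ le_iSup₂ (f := fun i (_ : P i) => g i) i hi') (hne i hi')
  rw [Finset.sup_eq_iSup] at h1
  simp only [Finset.mem_filter, Finset.mem_univ, true_and] at h1
  exact h1.ne h

end

/-! ### The main theorem -/

theorem theorem1 (p q k : ℕ) (hq : 2 ≤ q) (hpq : q ≤ p) (hk : 2 ≤ k)
    (A : Fin (k + 2) → ℂ → ℂ) (hA : ∀ j, Differentiable ℂ (A j))
    (c : Fin k → ℂ) (hc : Function.Injective c) (hc0 : ∀ j, c j ≠ 0)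
    (l m : Fin (k + 2))
    (h1_pos : 0 < max (entirePQLowerOrder p q (A m))
      (⨆ j : Fin (k + 2), ⨆ _ : j ≠ m ∧ j ≠ l, entirePQOrder p q (A j)))
    (h1_le : max (entirePQLowerOrder p q (A m))
      (⨆ j : Fin (k + 2), ⨆ _ : j ≠ m ∧ j ≠ l, entirePQOrder p q (A j))
        ≤ entirePQLowerOrder p q (A l))
    (h1_fin : entirePQLowerOrder p q (A l) < ⊤)
    (h2 : entirePQLowerOrder p q (A l) = entirePQLowerOrder p q (A m) →
      entirePQLowerType p q (A m) < entirePQLowerType p q (A l))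
    (h3 : entirePQLowerOrder p q (A l) =
        (⨆ j : Fin (k + 2), ⨆ _ : j ≠ m ∧ j ≠ l, entirePQOrder p q (A j)) →
      (⨆ j : Fin (k + 2), ⨆ _ : (j ≠ m ∧ j ≠ l) ∧
          entirePQOrder p q (A j) = entirePQLowerOrder p q (A l), entirePQType p q (A j))
        < entirePQLowerType p q (A l))
    (f : ℂ → ℂ) (hf : IsMeromorphicSolution A c f) (hf0 : ¬ f =ᶠ[codiscrete ℂ] 0) :
    entirePQLowerOrder p q (A l) ≤ meromorphicPQOrder p q f := by
  obtain ⟨n, rfl⟩ : ∃ n, p = n + 1 := ⟨p - 1, by omega⟩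
  obtain ⟨e, rfl⟩ : ∃ e, q = e + 1 := ⟨q - 1, by omega⟩
  have hn : 1 ≤ n := by omega
  have he : 1 ≤ e := by omega
  by_contra! hlt
  have hl0 : 0 < entirePQLowerOrder (n + 1) (e + 1) (A l) := h1_pos.trans_le h1_le
  obtain ⟨μ, hμ⟩ : ∃ μ : ℝ, entirePQLowerOrder (n + 1) (e + 1) (A l) = μ :=
    ⟨_, (EReal.coe_toReal h1_fin.ne (hl0.trans' EReal.bot_lt_zero).ne').symm⟩
  have hlM := tendsto_maxModulus_of_lowerOrder_pos (hA l) hl0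
  set S : EReal := ⨆ j : Fin (k + 2), ⨆ _ : j ≠ m ∧ j ≠ l,
    entirePQOrder (n + 1) (e + 1) (A j) with hS
  have hjS : ∀ j, j ≠ m ∧ j ≠ l → entirePQOrder (n + 1) (e + 1) (A j) ≤ S := fun j hj =>
    le_iSup₂ (f := fun j (_ : j ≠ m ∧ j ≠ l) => entirePQOrder (n + 1) (e + 1) (A j)) j hj
  rw [hμ] at h1_le h2 h3 hlt hl0
  have hμ0 : 0 < μ := EReal.coe_pos.1 hl0
  have hmμ := (le_max_left _ _).trans h1_le
  have hSμ := (le_max_right _ _).trans h1_le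
  have hev := tendsto_iterLog e
  -- With a gap below μ, the exponent β lies in it and types play no role; the larger exponent μ' <
  -- μ yields the factor 2 for A_l.
  by_cases hcase : max (entirePQLowerOrder (n + 1) (e + 1) (A m)) S < μ
  · obtain ⟨β, hβ1, hβ2⟩ := EReal.lt_iff_exists_real_btwn.1 (max_lt hcase hlt)
    obtain ⟨μ', hμ'1, hμ'2⟩ := exists_between (EReal.coe_lt_coe_iff.1 hβ2)
    obtain ⟨hβ3, hβ4⟩ := max_lt_iff.1 hβ1
    have hβ0 : 0 < β := EReal.coe_pos.1 (h1_pos.trans hβ3)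
    obtain ⟨hβ5, hβ6⟩ := max_lt_iff.1 hβ3
    -- `∃ᶠ` is a negated `∀ᶠ`, so the last goal is the eventual upper bound for T(r, f) that it
    -- refutes.
    refine frequently_characteristic_gt_of_dominant_coefficient hn he hA hf hf0 (m := m) hβ0
      one_pos one_lt_two hlM ?_ ?_ ?_ ?_
    · filter_upwards [eventually_le_of_lt_lowerOrder hlM
        (hμ ▸ EReal.coe_lt_coe_iff.2 hμ'2 : (μ' : EReal) < _),
        eventually_iterLog_rpow_le hμ'1 one_half_pos e] with r h4 h5
      linarith
    · intro j hj
      simpa using eventually_le_of_order_lt ((hjS j hj).trans_lt hβ6)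
    · simpa using frequently_le_of_lowerOrder_lt hβ5
    · simpa using eventually_le_of_meromorphicOrder_lt hβ4
  -- The value t bounds the types of all competitors whose order (lower order for A_m) equals μ; t ≥
  -- 0 makes a > t positive, so competitors of smaller order are absorbed by a (log_e r)^μ.
  · obtain ⟨t, ht0, htl, htm, htj⟩ : ∃ t : EReal, 0 ≤ t ∧
        t < entirePQLowerType (n + 1) (e + 1) (A l) ∧
        (entirePQLowerOrder (n + 1) (e + 1) (A m) = μ →
          entirePQLowerType (n + 1) (e + 1) (A m) ≤ t) ∧
        ∀ j, j ≠ m ∧ j ≠ l → entirePQOrder (n + 1) (e + 1) (A j) = μ →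
          entirePQType (n + 1) (e + 1) (A j) ≤ t := by
      set τ : EReal := ⨆ j : Fin (k + 2), ⨆ _ : (j ≠ m ∧ j ≠ l) ∧
        entirePQOrder (n + 1) (e + 1) (A j) = μ, entirePQType (n + 1) (e + 1) (A j) with hτ
      have hjτ : ∀ j, j ≠ m ∧ j ≠ l → entirePQOrder (n + 1) (e + 1) (A j) = μ →
          entirePQType (n + 1) (e + 1) (A j) ≤ τ := fun j hj hjμ =>
        le_iSup₂ (f := fun j (_ : (j ≠ m ∧ j ≠ l) ∧ entirePQOrder (n + 1) (e + 1) (A j) = μ) =>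
          entirePQType (n + 1) (e + 1) (A j)) j ⟨hj, hjμ⟩
      have hmnn : entirePQLowerOrder (n + 1) (e + 1) (A m) = μ →
          0 ≤ entirePQLowerType (n + 1) (e + 1) (A m) := fun h =>
        entirePQLowerType_nonneg (tendsto_maxModulus_of_lowerOrder_pos (hA m) (h ▸ hl0)) _ _
      have hτnn : S = μ → 0 ≤ τ := fun h => by
        obtain ⟨j, hj, hjμ⟩ := exists_eq_of_iSup_eq (EReal.bot_lt_coe μ) h
        exact (entirePQType_nonneg (tendsto_maxModulus_of_order_pos (hA j) (hjμ ▸ hl0))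
          _ _).trans (hjτ j hj hjμ)
      by_cases hm : entirePQLowerOrder (n + 1) (e + 1) (A m) = μ
      · by_cases hs : S = μ
        · exact ⟨max (entirePQLowerType (n + 1) (e + 1) (A m)) τ,
            (hmnn hm).trans (le_max_left _ _), max_lt (h2 hm.symm) (h3 hs.symm),
            fun _ => le_max_left _ _, fun j hj hjμ => (hjτ j hj hjμ).trans (le_max_right _ _)⟩
        · exact ⟨_, hmnn hm, h2 hm.symm, fun _ => le_rfl, fun j hj hjμ =>
            absurd (hSμ.antisymm (hjμ ▸ hjS j hj)) hs⟩
      · have hs : S = μ := by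
          by_contra hs
          exact hcase (max_lt (lt_of_le_of_ne hmμ hm) (lt_of_le_of_ne hSμ hs))
        exact ⟨τ, hτnn hs, h3 hs.symm, fun h => absurd h hm, hjτ⟩
    obtain ⟨a, hta, hal⟩ := EReal.lt_iff_exists_real_btwn.1 htl
    obtain ⟨b, hab, hbl⟩ := EReal.lt_iff_exists_real_btwn.1 hal
    have ha0 : 0 < a := EReal.coe_pos.1 (ht0.trans_lt hta)
    refine frequently_characteristic_gt_of_dominant_coefficient hn he hA hf hf0 (m := m) hμ0
      ha0 (EReal.coe_lt_coe_iff.1 hab) hlM (eventually_le_of_lt_lowerType hμ hbl) ?_ ?_ ?_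
    · intro j hj
      rcases ((hjS j hj).trans hSμ).eq_or_lt with h | h
      · exact eventually_le_of_type_lt h ((htj j hj h).trans_lt hta)
      · obtain ⟨β, hβ1, hβ2⟩ := EReal.lt_iff_exists_real_btwn.1 h
        filter_upwards [eventually_le_of_order_lt hβ1,
          eventually_iterLog_rpow_le (EReal.coe_lt_coe_iff.1 hβ2) ha0 e] with r h4 h5
        exact h4.trans h5
    · rcases hmμ.eq_or_lt with h | h
      · exact frequently_le_of_lowerType_lt h ((htm h).trans_lt hta)
      · obtain ⟨β, hβ1, hβ2⟩ := EReal.lt_iff_exists_real_btwn.1 h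
        exact ((frequently_le_of_lowerOrder_lt hβ1).and_eventually
          (eventually_iterLog_rpow_le (EReal.coe_lt_coe_iff.1 hβ2) ha0 e)).mono
            fun r hr => hr.1.trans hr.2
    · obtain ⟨β, hβ1, hβ2⟩ := EReal.lt_iff_exists_real_btwn.1 hlt
      filter_upwards [eventually_le_of_meromorphicOrder_lt hβ1,
        eventually_iterLog_rpow_le (EReal.coe_lt_coe_iff.1 hβ2) ha0 e] with r h4 h5
      exact not_lt.2 (h4.trans h5)
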